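/- Theorem 3.1 (weakfac). Banach spaces are over $\mathbb{K}=\mathbb{R}$ or $\mathbb{C}$, and an operator is a bounded linear map between Banach spaces. For a Banach space $E$, a $w^*$-compact set $K\subseteq E^*$ and $\varepsilon>0$, let $$s_\varepsilon(K)=\{x\in K : \operatorname{diam}(K\cap V)>\varepsilon \text{ for every } w^*\text{-open } V\ni x\},$$ where the diameter is taken in the norm. Put $s_\varepsilon^0(K)=K$, $s_\varepsilon^{\beta+1}(K)=s_\varepsilon(s_\varepsilon^\beta(K))$ for every ordinal $\beta$, and $s_\varepsilon^\beta(K)=\bigcap_{\gamma<\beta}s_\varepsilon^\gamma(K)$ for every limit ordinal $\beta$. Let $\mathrm{Sz}_\varepsilon(K)$ be the class of all ordinals $\beta$ with $s_\varepsilon^\beta(K)\neq\emptyset$, and let $\mathrm{Sz}(K)=\bigcup_{\varepsilon>0}\mathrm{Sz}_\varepsilon(K)$; each of these is either an ordinal (identified with the set of all smaller ordinals) or the class of all ordinals. The Szlenk index of a Banach space $E$ is $\mathrm{Sz}(E)=\mathrm{Sz}(B_{E^*})$ and that of an operator $T:E\to F$ is $\mathrm{Sz}(T)=\mathrm{Sz}(T^*B_{F^*})$,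 where $B_{X^*}$ denotes the closed unit ball of $X^*$. For an ordinal $\alpha$, let $\mathscr{SZ}_\alpha$ be the class of all $\alpha$-Szlenk operators, that is, of all operators $T$ with $\mathrm{Sz}(T)\leq\omega^\alpha$. For classes of operators $\mathscr{I}$ and $\mathscr{J}$, say that $\mathscr{I}$ has the $\mathscr{J}$-factorization property if every $T\in\mathscr{I}$ can be written as $T=BA$ with operators $A:E\to G$ and $B:G\to F$, where $G$ is a Banach space whose identity operator belongs to $\mathscr{J}$. Then, for every ordinal $\alpha$, the class $\mathscr{SZ}_\alpha$ has the $\mathscr{SZ}_{\alpha+1}$-factorization property. That is, for all Banach spaces $E,F$ and every operator $T:E\to F$ with $\mathrm{Sz}(T)\leq\omega^\alpha$, there are a Banach space $G$ with $\mathrm{Sz}(G)\leq\omega^{\alpha+1}$ and operators $A:E\to G$, $B:G\to F$ such that $T=BA$. -/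

import Mathlib

open scoped Ordinal

universe u v

namespace SzlenkFactorization

section Szlenk

variable {𝕜 : Type v} [RCLike 𝕜] {E : Type u} [NormedAddCommGroup E] [NormedSpace 𝕜 E]

/-- The Szlenk derivation: `s_ε(K)` is the set of those `x ∈ K` such that `diam (K ∩ V) > ε` for
every weak-star open `V` containing `x`. The diameter is the norm diameter (valued in `[0, ∞]`, so
that there is no junk value for unbounded sets). -/
def szlenkDeriv (ε : ℝ) (K : Set (StrongDual 𝕜 E)) : Set (StrongDual 𝕜 E) :=
  {x | x ∈ K ∧ ∀ V : Set (WeakDual 𝕜 E), IsOpen V → StrongDual.toWeakDual x ∈ V →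
    ENNReal.ofReal ε < Metric.ediam (K ∩ StrongDual.toWeakDual ⁻¹' V)}

/-- The transfinite iterates `s_ε^α(K)` of the Szlenk derivation. -/
noncomputable def szlenkDerivIter (ε : ℝ) (K : Set (StrongDual 𝕜 E)) (α : Ordinal.{u}) :
    Set (StrongDual 𝕜 E) :=
  Ordinal.limitRecOn α K (fun _ S => szlenkDeriv ε S) (fun a _ S => ⋂ b, ⋂ h : b < a, S b h)

theorem szlenkDerivIter_zero (ε : ℝ) (K : Set (StrongDual 𝕜 E)) :
    szlenkDerivIter ε K 0 = K := by
  simp [szlenkDerivIter]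

theorem szlenkDerivIter_add_one (ε : ℝ) (K : Set (StrongDual 𝕜 E)) (α : Ordinal.{u}) :
    szlenkDerivIter ε K (α + 1) = szlenkDeriv ε (szlenkDerivIter ε K α) := by
  simp [szlenkDerivIter]

theorem szlenkDerivIter_limit (ε : ℝ) (K : Set (StrongDual 𝕜 E)) {α : Ordinal.{u}}
    (h : Order.IsSuccLimit α) :
    szlenkDerivIter ε K α = ⋂ β, ⋂ _ : β < α, szlenkDerivIter ε K β := by
  simp only [szlenkDerivIter]
  rw [Ordinal.limitRecOn_limit (h := h)]

/-- The `ε`-Szlenk index of `K`, as the class of all ordinals `α` with `s_ε^α(K) ≠ ∅`. This class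
is either a von Neumann ordinal (the class of all smaller ordinals) or the class of all
ordinals. -/
def epsSzlenkIndex (ε : ℝ) (K : Set (StrongDual 𝕜 E)) : Set Ordinal.{u} :=
  {α | (szlenkDerivIter ε K α).Nonempty}

/-- The Szlenk index of `K`: the union over `ε > 0` of the `ε`-Szlenk indices. -/
def szlenkIndex (K : Set (StrongDual 𝕜 E)) : Set Ordinal.{u} :=
  ⋃ (ε : ℝ) (_ : 0 < ε), epsSzlenkIndex ε K

variable (𝕜 E) in
/-- The Szlenk index of a Banach space: that of the closed unit ball of its dual. -/
def spaceSzlenkIndex : Set Ordinal.{u} :=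
  szlenkIndex (Metric.closedBall (0 : StrongDual 𝕜 E) 1)

/-- The Szlenk index of an operator `T : E → F`: that of the image of the closed unit ball of the
dual of `F` under the adjoint `f ↦ f ∘ T` of `T`. -/
def opSzlenkIndex {F : Type u} [NormedAddCommGroup F] [NormedSpace 𝕜 F] (T : E →L[𝕜] F) :
    Set Ordinal.{u} :=
  szlenkIndex ((fun f : StrongDual 𝕜 F => f.comp T) '' Metric.closedBall (0 : StrongDual 𝕜 F) 1)

end Szlenk

/-- An index, given as a class of ordinals, is at most the ordinal `β`, that is, contained in the
von Neumann ordinal `β = {γ | γ < β}`. -/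
def IndexLE (I : Set Ordinal.{u}) (β : Ordinal.{u}) : Prop :=
  I ⊆ Set.Iio β

/-- A class of Banach spaces over `𝕜`. -/
abbrev SpaceClass (𝕜 : Type v) [RCLike 𝕜] : Type (max v (u + 1)) :=
  ∀ (E : Type u) [NormedAddCommGroup E] [NormedSpace 𝕜 E] [CompleteSpace E], Prop

/-- A class of operators (bounded linear maps between Banach spaces) over `𝕜`. -/
abbrev OperatorClass (𝕜 : Type v) [RCLike 𝕜] : Type (max v (u + 1)) :=
  ∀ (E F : Type u) [NormedAddCommGroup E] [NormedSpace 𝕜 E] [CompleteSpace E]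
    [NormedAddCommGroup F] [NormedSpace 𝕜 F] [CompleteSpace F], (E →L[𝕜] F) → Prop

section Classes

variable {𝕜 : Type v} [RCLike 𝕜]

/-- `Space(𝒥)`: the Banach spaces whose identity operator belongs to `𝒥`. -/
def spacesOf (J : OperatorClass.{u, v} 𝕜) : SpaceClass.{u, v} 𝕜 :=
  fun E _ _ _ => J E E (ContinuousLinearMap.id 𝕜 E)

/-- `Op(I)`: the operators that admit a continuous linear factorization through a space in `I`. -/
def operatorsThrough (I : SpaceClass.{u, v} 𝕜) : OperatorClass.{u, v} 𝕜 :=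
  fun E F _ _ _ _ _ _ T =>
    ∃ (G : Type u) (_ : NormedAddCommGroup G) (_ : NormedSpace 𝕜 G) (_ : CompleteSpace G)
      (A : E →L[𝕜] G) (B : G →L[𝕜] F), I G ∧ T = B.comp A

/-- `ℐ` has the `𝒥`-factorization property: `ℐ ⊆ Op(Space(𝒥))`. -/
def HasFactorizationProperty (I J : OperatorClass.{u, v} 𝕜) : Prop :=
  ∀ (E F : Type u) [NormedAddCommGroup E] [NormedSpace 𝕜 E] [CompleteSpace E]
    [NormedAddCommGroup F] [NormedSpace 𝕜 F] [CompleteSpace F] (T : E →L[𝕜] F),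
    I E F T → operatorsThrough (spacesOf J) E F T

variable (𝕜) in
/-- The class `𝒮𝒵_α` of `α`-Szlenk operators: those of Szlenk index at most `ω ^ α`. -/
def szlenkOperators (α : Ordinal.{u}) : OperatorClass.{u, v} 𝕜 :=
  fun _ _ _ _ _ _ _ _ T => IndexLE (opSzlenkIndex T) (ω ^ α)

end Classes

end SzlenkFactorization

/-!
The factorization is a discrete real interpolation between `E` and the range of `T`. On `E`
consider the norms `|x|ₙ = max (2ⁿ ‖T x‖) (2⁻ⁿ ‖x‖)`, let `X` be the `ℓ²`-direct sum of the spaces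
`(E, |·|ₙ)`, and let `G` be the quotient of `X` by the kernel of `(xₙ) ↦ ∑ T xₙ`. Then `T` factors
through `G` by `A : x ↦ [(x, 0, 0, …)]` and `B : [(xₙ)] ↦ ∑ T xₙ`. The class of a vector `x` of `E`
in `G` does not depend on the summand in which `x` is placed.

Two features of `G` bound its Szlenk index. Placing `x` in the `n`-th summand gives
`|A* g (x)| ≤ 2ⁿ ‖T x‖ + 2⁻ⁿ ‖x‖` for `g` in the dual unit ball, so by Hahn-Banach `A*` maps this
ball into `2ⁿ T* B_{F*} + 2⁻ⁿ B_{E*}` for every `n` (`exists_near_adjoint_image`). On the other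
hand, if `g` has norm close to the radius `r ≤ 1` of a dual ball, then by the `ℓ²`-structure there
is a weak-star slice of that ball around `g` in which functionals are small on late summands
(`norm_apply_tail_le`), while on the first `m` summands their norm is controlled by that of their
image under `A*` (`norm_sub_le_of_slice`).

In such a slice, the `ε`-derivations of the ball can therefore be compared with derivations of
`T* B_{F*}` (`exists_szlenkDerivIter_near`). The latter vanish after `ω ^ α` steps, so
`s_ε^{ω^α}(r B_{G*}) ⊆ (r - δ) B_{G*}` with `δ` depending on `ε` only
(`szlenkDerivIter_closedBall_subset`). After finitely many rounds nothing is left, that is,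
`s_ε^{ω^α n}(B_{G*}) = ∅` for some `n`, and `ω ^ α * n < ω ^ (α + 1)`.
-/

namespace SzlenkFactorization

/-! ### Szlenk derivations -/

section Derivation

variable {𝕜 : Type v} [RCLike 𝕜] {E : Type u} [NormedAddCommGroup E] [NormedSpace 𝕜 E]

theorem szlenkDeriv_subset (ε : ℝ) (K : Set (StrongDual 𝕜 E)) : szlenkDeriv ε K ⊆ K :=
  fun _ hx => hx.1

theorem szlenkDeriv_mono (ε : ℝ) {K L : Set (StrongDual 𝕜 E)} (h : K ⊆ L) :
    szlenkDeriv ε K ⊆ szlenkDeriv ε L :=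
  fun _ hx => ⟨h hx.1, fun V hV hxV =>
    (hx.2 V hV hxV).trans_le (Metric.ediam_mono (Set.inter_subset_inter_left _ h))⟩

theorem szlenkDerivIter_mono (ε : ℝ) {K L : Set (StrongDual 𝕜 E)} (h : K ⊆ L)
    (β : Ordinal.{u}) : szlenkDerivIter ε K β ⊆ szlenkDerivIter ε L β := by
  induction β using Ordinal.limitRecOn with
  | zero => simpa only [szlenkDerivIter_zero] using h
  | add_one β ih => simpa only [szlenkDerivIter_add_one] using szlenkDeriv_mono ε ih
  | limit β hβ ih =>
    simp only [szlenkDerivIter_limit _ _ hβ]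
    exact Set.iInter₂_mono ih

theorem szlenkDerivIter_antitone (ε : ℝ) (K : Set (StrongDual 𝕜 E)) :
    Antitone (szlenkDerivIter ε K) := by
  intro γ β h
  induction β using Ordinal.limitRecOn with
  | zero => rw [nonpos_iff_eq_zero.1 h]
  | add_one β ih =>
    rcases h.eq_or_lt with rfl | h
    · rfl
    · rw [szlenkDerivIter_add_one]
      exact (szlenkDeriv_subset _ _).trans (ih (Order.lt_add_one_iff.1 h))
  | limit β hβ ih =>
    rcases h.eq_or_lt with rfl | h
    · rfl
    · rw [szlenkDerivIter_limit _ _ hβ]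
      exact Set.iInter₂_subset γ h

/-- Iterating `β + γ` times is iterating `γ` times after `β` times; this inclusion suffices for
bounding indices. -/
theorem szlenkDerivIter_add_subset (ε : ℝ) (K : Set (StrongDual 𝕜 E)) (β γ : Ordinal.{u}) :
    szlenkDerivIter ε K (β + γ) ⊆ szlenkDerivIter ε (szlenkDerivIter ε K β) γ := by
  induction γ using Ordinal.limitRecOn with
  | zero => simp only [add_zero, szlenkDerivIter_zero, subset_refl]
  | add_one γ ih =>
    rw [← add_assoc, szlenkDerivIter_add_one, szlenkDerivIter_add_one]
    exact szlenkDeriv_mono ε ih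
  | limit γ hγ ih =>
    rw [szlenkDerivIter_limit _ _ hγ]
    exact Set.subset_iInter₂ fun c hc =>
      (szlenkDerivIter_antitone ε K (add_le_add_right hc.le β)).trans (ih c hc)

theorem isClosed_szlenkDeriv (ε : ℝ) {K : Set (StrongDual 𝕜 E)}
    (hK : IsClosed (WeakDual.toStrongDual (𝕜 := 𝕜) (E := E) ⁻¹' K)) :
    IsClosed (WeakDual.toStrongDual (𝕜 := 𝕜) (E := E) ⁻¹' szlenkDeriv ε K) := by
  rw [← isOpen_compl_iff, isOpen_iff_mem_nhds]
  intro x hx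
  by_cases hxK : WeakDual.toStrongDual x ∈ K
  · have : ∃ V : Set (WeakDual 𝕜 E), IsOpen V ∧ x ∈ V ∧
        Metric.ediam (K ∩ StrongDual.toWeakDual ⁻¹' V) ≤ ENNReal.ofReal ε := by
      by_contra! H
      exact hx ⟨hxK, fun V hV hxV => H V hV hxV⟩
    obtain ⟨V, hV, hxV, hd⟩ := this
    filter_upwards [hV.mem_nhds hxV] with y hy hy'
    exact (hy'.2 V hV hy).not_ge hd
  · filter_upwards [hK.isOpen_compl.mem_nhds hxK] with y hy hy'
    exact hy hy'.1

theorem isCompact_szlenkDerivIter (ε : ℝ) {K : Set (StrongDual 𝕜 E)}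
    (hK : IsCompact (WeakDual.toStrongDual (𝕜 := 𝕜) (E := E) ⁻¹' K)) (β : Ordinal.{u}) :
    IsCompact (WeakDual.toStrongDual (𝕜 := 𝕜) (E := E) ⁻¹' szlenkDerivIter ε K β) := by
  have hcl : IsClosed (WeakDual.toStrongDual (𝕜 := 𝕜) (E := E) ⁻¹' szlenkDerivIter ε K β) := by
    induction β using Ordinal.limitRecOn with
    | zero => simpa only [szlenkDerivIter_zero] using hK.isClosed
    | add_one β ih =>
      rw [szlenkDerivIter_add_one]
      exact isClosed_szlenkDeriv ε ih
    | limit β hβ ih =>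
      simp only [szlenkDerivIter_limit _ _ hβ, Set.preimage_iInter]
      exact isClosed_iInter fun γ => isClosed_iInter (ih γ)
  refine hK.of_isClosed_subset hcl (Set.preimage_mono ?_)
  simpa only [szlenkDerivIter_zero] using szlenkDerivIter_antitone ε K (zero_le (a := β))

/-- The adjoint of a bounded operator, as a map between weak-star duals. -/
noncomputable def weakAdjoint {G : Type u} [NormedAddCommGroup G] [NormedSpace 𝕜 G] (A : E →L[𝕜] G)
    (g : WeakDual 𝕜 G) : WeakDual 𝕜 E :=
  StrongDual.toWeakDual ((WeakDual.toStrongDual g).comp A)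

theorem continuous_weakAdjoint {G : Type u} [NormedAddCommGroup G] [NormedSpace 𝕜 G]
    (A : E →L[𝕜] G) : Continuous (weakAdjoint A) :=
  WeakDual.continuous_of_continuous_eval fun y => WeakDual.eval_continuous (A y)

theorem isCompact_adjoint_image {F : Type u} [NormedAddCommGroup F] [NormedSpace 𝕜 F]
    (T : E →L[𝕜] F) :
    IsCompact (WeakDual.toStrongDual (𝕜 := 𝕜) (E := E) ⁻¹'
      ((fun f : StrongDual 𝕜 F => f.comp T) '' Metric.closedBall (0 : StrongDual 𝕜 F) 1)) := by
  convert (WeakDual.isCompact_closedBall (𝕜 := 𝕜) (0 : StrongDual 𝕜 F) 1).image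
    (continuous_weakAdjoint T) using 1
  ext f
  exact Iff.rfl

end Derivation

/-! ### Comparison of derivations along an adjoint -/

section Comparison

variable {𝕜 : Type v} [RCLike 𝕜] {E G : Type u} [NormedAddCommGroup E] [NormedSpace 𝕜 E]
  [NormedAddCommGroup G] [NormedSpace 𝕜 G]

open Filter Topology

theorem isCompact_near {K : Set (StrongDual 𝕜 E)}
    (hK : IsCompact (WeakDual.toStrongDual (𝕜 := 𝕜) (E := E) ⁻¹' K)) (f : StrongDual 𝕜 E) (c : 𝕜)
    (η : ℝ) :
    IsCompact (WeakDual.toStrongDual (𝕜 := 𝕜) (E := E) ⁻¹' {y | y ∈ K ∧ ‖f - c • y‖ ≤ η}) := by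
  have hcont : Continuous fun y : WeakDual 𝕜 E => StrongDual.toWeakDual f - c • y := by fun_prop
  convert hK.inter_right ((WeakDual.isClosed_closedBall (0 : StrongDual 𝕜 E) η).preimage hcont)
    using 1
  ext y
  simp only [Set.mem_preimage, Set.mem_ofPred_eq, Set.mem_inter_iff, mem_closedBall_zero_iff]
  exact Iff.rfl

/-- One derivation step of the comparison along `A*`. If `A*` maps `M ∩ V` into the
`η`-neighbourhood of `c K` and controls the norm on `M ∩ V` at scale `ε`, then it maps the part of
`s_ε(M)` in `V` into the `η`-neighbourhood of `c s_{η'}(K)`. A point `g` of `s_ε(M)` in `V` is a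
weak-star limit of points `h` of `M` with `A* h` far from `A* g`; any cluster point of
approximants `y_h ∈ K` of `A* h` is the required point. -/
theorem exists_szlenkDeriv_near (A : E →L[𝕜] G) (c : 𝕜) {ε η η' : ℝ} (hc : ‖c‖ * η' ≤ η)
    (hη' : 0 ≤ η')
    {K : Set (StrongDual 𝕜 E)} (hK : IsCompact (WeakDual.toStrongDual (𝕜 := 𝕜) (E := E) ⁻¹' K))
    {M : Set (StrongDual 𝕜 G)} {V : Set (WeakDual 𝕜 G)} (hV : IsOpen V)
    (hnear : ∀ g ∈ M, StrongDual.toWeakDual g ∈ V → ∃ y ∈ K, ‖g.comp A - c • y‖ ≤ η)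
    (hsmall : ∀ g ∈ M, ∀ h ∈ M, StrongDual.toWeakDual g ∈ V → StrongDual.toWeakDual h ∈ V →
      ‖h.comp A - g.comp A‖ ≤ 3 * η → ‖h - g‖ ≤ ε / 2)
    {g : StrongDual 𝕜 G} (hg : g ∈ szlenkDeriv ε M) (hgV : StrongDual.toWeakDual g ∈ V) :
    ∃ y ∈ szlenkDeriv η' K, ‖g.comp A - c • y‖ ≤ η := by
  -- the points of `M ∩ V` far from `g` along `A*` accumulate at `g`
  set S : Set (WeakDual 𝕜 G) := {h | WeakDual.toStrongDual h ∈ M ∧ h ∈ V ∧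
    3 * η < ‖(WeakDual.toStrongDual h).comp A - g.comp A‖} with hS
  have hcl : StrongDual.toWeakDual g ∈ closure S := by
    rw [mem_closure_iff]
    intro U hU hgU
    by_contra hne
    refine (hg.2 (U ∩ V) (hU.inter hV) ⟨hgU, hgV⟩).not_ge ?_
    have hall : ∀ h ∈ M ∩ StrongDual.toWeakDual ⁻¹' (U ∩ V), ‖h - g‖ ≤ ε / 2 := by
      intro h hh
      refine hsmall g hg.1 h hh.1 hgV hh.2.2 ?_
      by_contra! hlt
      exact hne ⟨StrongDual.toWeakDual h, hh.2.1, hh.1, hh.2.2, hlt⟩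
    refine Metric.ediam_le fun h hh k hk => ?_
    rw [edist_dist]
    refine ENNReal.ofReal_le_ofReal ?_
    have h1 := hall h hh
    have h2 := hall k hk
    rw [← dist_eq_norm] at h1 h2
    linarith [dist_triangle_right h k g]
  obtain ⟨l, hSl, hlg⟩ := mem_closure_iff_ultrafilter.1 hcl
  -- approximants in `K` of the points of `S`
  have hex : ∀ h : WeakDual 𝕜 G, ∃ y : WeakDual 𝕜 E, h ∈ S →
      WeakDual.toStrongDual y ∈ K ∧
        ‖(WeakDual.toStrongDual h).comp A - c • WeakDual.toStrongDual y‖ ≤ η := by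
    intro h
    by_cases hh : h ∈ S
    · obtain ⟨y, hy, hy'⟩ := hnear _ hh.1 hh.2.1
      exact ⟨StrongDual.toWeakDual y, fun _ => ⟨hy, hy'⟩⟩
    · exact ⟨0, fun h' => absurd h' hh⟩
  choose φ hφ using hex
  have hφK : ∀ᶠ h in (l : Filter _), φ h ∈ WeakDual.toStrongDual (𝕜 := 𝕜) (E := E) ⁻¹' K :=
    mem_of_superset hSl fun h hh => (hφ h hh).1
  obtain ⟨y, hyK, hy⟩ := hK.ultrafilter_le_nhds' (l.map φ) hφK
  have hyt : Tendsto φ l (𝓝 y) := hy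
  have hAt : Tendsto (weakAdjoint A) l (𝓝 (weakAdjoint A (StrongDual.toWeakDual g))) :=
    (continuous_weakAdjoint A).continuousAt.mono_left hlg
  have hdiff : Tendsto (fun h => weakAdjoint A h - c • φ h) l
      (𝓝 (weakAdjoint A (StrongDual.toWeakDual g) - c • y)) := hAt.sub (hyt.const_smul c)
  have hyg : ‖g.comp A - c • WeakDual.toStrongDual y‖ ≤ η := by
    have := (WeakDual.isClosed_closedBall (0 : StrongDual 𝕜 E) η).mem_of_tendsto hdiff
      (mem_of_superset hSl fun h hh => mem_closedBall_zero_iff.2 (hφ h hh).2)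
    exact mem_closedBall_zero_iff.1 this
  refine ⟨WeakDual.toStrongDual y, ⟨hyK, fun W hW hyW => ?_⟩, hyg⟩
  -- otherwise some `y_h` is `η'`-close to `y`, which puts `A* h` within `3η` of `A* g`
  by_contra! hd
  have hφW : ∀ᶠ h in (l : Filter _), φ h ∈ W := hyt (hW.mem_nhds hyW)
  obtain ⟨h, hhS, hhW⟩ := ((show ∀ᶠ h in (l : Filter _), h ∈ S from hSl).and hφW).exists
  have hdist : ‖WeakDual.toStrongDual (φ h) - WeakDual.toStrongDual y‖ ≤ η' := by
    rw [← dist_eq_norm, ← ENNReal.ofReal_le_ofReal_iff hη', ← edist_dist]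
    exact (Metric.edist_le_ediam_of_mem (s := K ∩ StrongDual.toWeakDual ⁻¹' W)
      ⟨(hφ h hhS).1, hhW⟩ ⟨hyK, hyW⟩).trans hd
  refine absurd hhS.2.2 (not_lt.2 ?_)
  have e : (WeakDual.toStrongDual h).comp A - g.comp A
      = ((WeakDual.toStrongDual h).comp A - c • WeakDual.toStrongDual (φ h))
        + c • (WeakDual.toStrongDual (φ h) - WeakDual.toStrongDual y)
        - (g.comp A - c • WeakDual.toStrongDual y) := by
    rw [smul_sub]; abel
  rw [e]
  refine (norm_sub_le _ _).trans ?_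
  have h1 := norm_add_le ((WeakDual.toStrongDual h).comp A - c • WeakDual.toStrongDual (φ h))
    (c • (WeakDual.toStrongDual (φ h) - WeakDual.toStrongDual y))
  have h2 := (hφ h hhS).2
  have h3 : ‖c • (WeakDual.toStrongDual (φ h) - WeakDual.toStrongDual y)‖ ≤ η := by
    rw [norm_smul]
    exact (mul_le_mul_of_nonneg_left hdist (norm_nonneg c)).trans hc
  linarith

/-- The comparison along `A*` for all iterates. It is local: only the norm on `M ∩ V` has to be
controlled by `A*`. -/
theorem exists_szlenkDerivIter_near (A : E →L[𝕜] G) (c : 𝕜) {ε η η' : ℝ} (hc : ‖c‖ * η' ≤ η)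
    (hη' : 0 ≤ η')
    {K : Set (StrongDual 𝕜 E)} (hK : IsCompact (WeakDual.toStrongDual (𝕜 := 𝕜) (E := E) ⁻¹' K))
    {M : Set (StrongDual 𝕜 G)} {V : Set (WeakDual 𝕜 G)} (hV : IsOpen V)
    (hnear : ∀ g ∈ M, ∃ y ∈ K, ‖g.comp A - c • y‖ ≤ η)
    (hsmall : ∀ g ∈ M, ∀ h ∈ M, StrongDual.toWeakDual g ∈ V → StrongDual.toWeakDual h ∈ V →
      ‖h.comp A - g.comp A‖ ≤ 3 * η → ‖h - g‖ ≤ ε / 2)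
    (β : Ordinal.{u}) {g : StrongDual 𝕜 G} (hg : g ∈ szlenkDerivIter ε M β)
    (hgV : StrongDual.toWeakDual g ∈ V) :
    ∃ y ∈ szlenkDerivIter η' K β, ‖g.comp A - c • y‖ ≤ η := by
  induction β using Ordinal.limitRecOn generalizing g with
  | zero =>
    rw [szlenkDerivIter_zero] at hg ⊢
    exact hnear g hg
  | add_one β ih =>
    rw [szlenkDerivIter_add_one] at hg ⊢
    have hsub : szlenkDerivIter ε M β ⊆ M := by
      simpa only [szlenkDerivIter_zero] using szlenkDerivIter_antitone ε M (zero_le (a := β))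
    exact exists_szlenkDeriv_near A c hc hη' (isCompact_szlenkDerivIter η' hK β) hV
      (fun g hg hgV => ih hg hgV)
      (fun g hg h hh => hsmall g (hsub hg) h (hsub hh)) hg hgV
  | limit β hβ ih =>
    have hcpt := fun γ => isCompact_near (isCompact_szlenkDerivIter η' hK γ) (g.comp A) c η
    have : Nonempty (Set.Iio β) := ⟨⟨0, hβ.bot_lt⟩⟩
    obtain ⟨y, hy⟩ := IsCompact.nonempty_iInter_of_directed_nonempty_isCompact_isClosed
      (fun γ : Set.Iio β => WeakDual.toStrongDual (𝕜 := 𝕜) (E := E) ⁻¹'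
        {y | y ∈ szlenkDerivIter η' K γ ∧ ‖g.comp A - c • y‖ ≤ η})
      (Antitone.directed_ge fun γ δ h y hy => ⟨szlenkDerivIter_antitone η' K h hy.1, hy.2⟩)
      (fun γ => by
        obtain ⟨y, hy, hy'⟩ := ih γ γ.2 (szlenkDerivIter_antitone ε M (le_of_lt γ.2) hg) hgV
        exact ⟨StrongDual.toWeakDual y, hy, hy'⟩)
      (fun γ => hcpt γ) (fun γ => (hcpt γ).isClosed)
    rw [Set.mem_iInter] at hy
    refine ⟨WeakDual.toStrongDual y, ?_, (hy ⟨0, hβ.bot_lt⟩).2⟩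
    rw [szlenkDerivIter_limit _ _ hβ]
    exact Set.mem_iInter₂.2 fun γ hγ => (hy ⟨γ, hγ⟩).1

end Comparison

/-! ### Slices of dual balls -/

section Slices

variable {𝕜 : Type v} [RCLike 𝕜] {E X G : Type u} [NormedAddCommGroup E] [NormedSpace 𝕜 E]
  [NormedAddCommGroup X] [NormedSpace 𝕜 X] [NormedAddCommGroup G] [NormedSpace 𝕜 G]

open Filter Topology

/-- A sequence of linear projections `P m` that split the norm of `X` as an `ℓ²`-sum and converge
pointwise to the identity, such as the initial segments of an `ℓ²`-direct sum. -/
structure IsPythagorean (P : ℕ → X →ₗ[𝕜] X) : Prop where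
  norm_sq : ∀ m z, ‖z‖ ^ 2 = ‖P m z‖ ^ 2 + ‖z - P m z‖ ^ 2
  idem : ∀ m z, P m (P m z) = P m z
  tendsto : ∀ z, Tendsto (fun m => P m z) atTop (𝓝 z)

theorem IsPythagorean.norm_apply_le {P : ℕ → X →ₗ[𝕜] X} (hP : IsPythagorean P) (m : ℕ) (z : X) :
    ‖P m z‖ ≤ ‖z‖ := by
  refine abs_le_of_sq_le_sq' ?_ (norm_nonneg z) |>.2
  nlinarith [hP.norm_sq m z]

theorem IsPythagorean.norm_sub_apply_le {P : ℕ → X →ₗ[𝕜] X} (hP : IsPythagorean P) (m : ℕ)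
    (z : X) : ‖z - P m z‖ ≤ ‖z‖ := by
  refine abs_le_of_sq_le_sq' ?_ (norm_nonneg z) |>.2
  nlinarith [hP.norm_sq m z]

theorem IsPythagorean.norm_head_add_tail {P : ℕ → X →ₗ[𝕜] X} (hP : IsPythagorean P) {m : ℕ}
    {x z : X} (hx : P m x = x) (hz : P m z = 0) : ‖x + z‖ ^ 2 = ‖x‖ ^ 2 + ‖z‖ ^ 2 := by
  have := hP.norm_sq m (x + z)
  rwa [map_add, hx, hz, add_zero, add_sub_cancel_left] at this

/-- A functional almost attains its norm at a vector fixed by some `P m`. -/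
theorem exists_re_apply_gt {P : ℕ → X →ₗ[𝕜] X} (hP : IsPythagorean P) {f : StrongDual 𝕜 X}
    {s : ℝ} (hs : s < ‖f‖) : ∃ m x, P m x = x ∧ ‖x‖ ≤ 1 ∧ s < RCLike.re (f x) := by
  -- for negative `s` the norm is no guide (`f` may vanish), but the zero vector works
  rcases lt_or_ge s 0 with h0 | h0
  · exact ⟨0, 0, map_zero _, by simp, by simpa using h0⟩
  obtain ⟨z, hz, hfz⟩ := f.exists_lt_apply_of_lt_opNorm hs
  obtain ⟨a, ha, haz⟩ := RCLike.exists_norm_eq_mul_self (f z)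
  have hlim : Tendsto (fun m => RCLike.re (f (P m (a • z)))) atTop
      (𝓝 (RCLike.re (f (a • z)))) :=
    (RCLike.continuous_re.comp f.continuous).continuousAt.tendsto.comp (hP.tendsto (a • z))
  have hgt : s < RCLike.re (f (a • z)) := by
    rw [map_smul, smul_eq_mul, ← haz, RCLike.ofReal_re]
    exact hfz
  obtain ⟨m, hm⟩ := (hlim.eventually (lt_mem_nhds hgt)).exists
  refine ⟨m, P m (a • z), hP.idem m _, (hP.norm_apply_le m _).trans ?_, hm⟩
  rw [norm_smul, ha, one_mul]
  exact hz.le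

/-- A functional of norm at most `r ≤ 1` that is within `τ² / 2` of `r` at a vector of the unit
ball is at most `τ` on the unit vectors that are orthogonal to it. -/
theorem norm_apply_tail_le {P : ℕ → X →ₗ[𝕜] X} (hP : IsPythagorean P) {f : StrongDual 𝕜 X}
    {r τ : ℝ} (hr : r ≤ 1) (hτ : 0 < τ) (hf : ‖f‖ ≤ r) {m : ℕ} {x z : X} (hx : P m x = x)
    (hx1 : ‖x‖ ≤ 1) (hfx : r - τ ^ 2 / 2 < RCLike.re (f x)) (hz : P m z = 0) (hz1 : ‖z‖ ≤ 1) :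
    ‖f z‖ ≤ τ := by
  obtain ⟨a, ha, haz⟩ := RCLike.exists_norm_eq_mul_self (f z)
  set w : X := ((τ : 𝕜) * a) • z with hw
  have hPw : P m w = 0 := by rw [hw, map_smul, hz, smul_zero]
  have hnw : ‖w‖ ≤ τ := by
    rw [hw, norm_smul, norm_mul, ha, mul_one, RCLike.norm_ofReal, abs_of_pos hτ]
    exact mul_le_of_le_one_right hτ.le hz1
  have hfw : RCLike.re (f w) = τ * ‖f z‖ := by
    rw [hw, map_smul, smul_eq_mul, mul_assoc, ← haz, ← RCLike.ofReal_mul, RCLike.ofReal_re]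
  have hr0 : 0 ≤ r := (norm_nonneg f).trans hf
  -- `‖x + w‖² ≤ 1 + τ² ≤ (1 + τ² / 2)²`
  have hn : ‖x + w‖ ≤ 1 + τ ^ 2 / 2 := by
    refine abs_le_of_sq_le_sq' ?_ (by positivity) |>.2
    rw [hP.norm_head_add_tail hx hPw]
    nlinarith [norm_nonneg x, norm_nonneg w, sq_nonneg (τ ^ 2)]
  have hle : RCLike.re (f (x + w)) ≤ r * (1 + τ ^ 2 / 2) :=
    (RCLike.re_le_norm _).trans ((f.le_opNorm _).trans
      (mul_le_mul hf hn (norm_nonneg _) hr0))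
  rw [map_add, map_add, hfw] at hle
  have hrτ : r * (τ ^ 2 / 2) ≤ τ ^ 2 / 2 := mul_le_of_le_one_left (by positivity) hr
  nlinarith

/-- Two functionals in the same slice are close as soon as they are close on initial segments. -/
theorem norm_sub_le_of_slice {P : ℕ → X →ₗ[𝕜] X} (hP : IsPythagorean P) {f g : StrongDual 𝕜 X}
    {r τ κ : ℝ} (hr : r ≤ 1) (hτ : 0 < τ) (hf : ‖f‖ ≤ r) (hg : ‖g‖ ≤ r) {m : ℕ} {x : X}
    (hx : P m x = x) (hx1 : ‖x‖ ≤ 1) (hfx : r - τ ^ 2 / 2 < RCLike.re (f x))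
    (hgx : r - τ ^ 2 / 2 < RCLike.re (g x)) (hκ : 0 ≤ κ)
    (hhead : ∀ z, ‖(f - g) (P m z)‖ ≤ κ * ‖z‖) : ‖f - g‖ ≤ κ + 2 * τ := by
  refine ContinuousLinearMap.opNorm_le_of_unit_norm (𝕜 := 𝕜) (by positivity) fun z hz => ?_
  have htail : P m (z - P m z) = 0 := by rw [map_sub, hP.idem, sub_self]
  have htail1 : ‖z - P m z‖ ≤ 1 := (hP.norm_sub_apply_le m z).trans hz.le
  have h1 := hhead z
  have h2 := norm_apply_tail_le hP hr hτ hf hx hx1 hfx htail htail1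
  have h3 := norm_apply_tail_le hP hr hτ hg hx hx1 hgx htail htail1
  have e : (f - g) z = (f - g) (P m z) + (f (z - P m z) - g (z - P m z)) := by
    rw [← sub_apply, ← map_add, add_sub_cancel]
  rw [hz, mul_one] at h1
  rw [e]
  refine (norm_add_le _ _).trans ?_
  linarith [norm_sub_le (f (z - P m z)) (g (z - P m z))]

/-- Deriving the dual ball of radius `r ≤ 1` of a quotient `G` of `X` up to the index `β` of `K`
reduces the radius by an amount that depends on `ε` only. A functional of larger norm lies in a
weak-star open slice on which the norm is controlled, up to `ε / 4`, by finitely many summands and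
hence by `A*`, so the comparison with `K` applies. -/
theorem szlenkDerivIter_closedBall_subset {P : ℕ → X →ₗ[𝕜] X} (hP : IsPythagorean P)
    (A : E →L[𝕜] G) {π : X →L[𝕜] G} (hπ : ∀ g : StrongDual 𝕜 G, ‖g.comp π‖ = ‖g‖)
    (hA : ∀ m, ∃ C : ℝ, ∀ z, ∃ x, π (P m z) = A x ∧ ‖x‖ ≤ C * ‖z‖)
    {K : Set (StrongDual 𝕜 E)} (hK : IsCompact (WeakDual.toStrongDual (𝕜 := 𝕜) (E := E) ⁻¹' K))
    (hnear : ∀ η > 0, ∃ c : 𝕜, ∀ g : StrongDual 𝕜 G, ‖g‖ ≤ 1 → ∃ y ∈ K, ‖g.comp A - c • y‖ ≤ η)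
    {β : Ordinal.{u}} (hβ : ∀ ε > 0, szlenkDerivIter ε K β = ∅) {ε r : ℝ} (hε : 0 < ε)
    (hr : r ≤ 1) :
    szlenkDerivIter ε (Metric.closedBall (0 : StrongDual 𝕜 G) r) β ⊆
      Metric.closedBall 0 (r - (ε / 8) ^ 2 / 2) := by
  intro g hg
  rw [mem_closedBall_zero_iff]
  by_contra! hlt
  rw [← hπ] at hlt
  obtain ⟨m, x, hx, hx1, hgx⟩ := exists_re_apply_gt hP hlt
  obtain ⟨C, hC⟩ := hA m
  set η : ℝ := ε / (12 * (|C| + 1)) with hη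
  have hη0 : 0 < η := by positivity
  obtain ⟨c, hc⟩ := hnear η hη0
  have hη' : 0 < η / (‖c‖ + 1) := by positivity
  have hcη : ‖c‖ * (η / (‖c‖ + 1)) ≤ η := by
    rw [mul_div_left_comm]
    exact mul_le_of_le_one_right hη0.le (div_le_one_of_le₀ (by linarith) (by positivity))
  let V : Set (WeakDual 𝕜 G) := {h | r - (ε / 8) ^ 2 / 2 < RCLike.re (h (π x))}
  have hV : IsOpen V := isOpen_lt continuous_const
    (RCLike.continuous_re.comp (WeakDual.eval_continuous (π x)))
  have hsmall : ∀ g ∈ Metric.closedBall (0 : StrongDual 𝕜 G) r,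
      ∀ h ∈ Metric.closedBall (0 : StrongDual 𝕜 G) r, StrongDual.toWeakDual g ∈ V →
      StrongDual.toWeakDual h ∈ V → ‖h.comp A - g.comp A‖ ≤ 3 * η → ‖h - g‖ ≤ ε / 2 := by
    intro g hg h hh hgV hhV hgh
    rw [mem_closedBall_zero_iff] at hg hh
    rw [← hπ, ContinuousLinearMap.sub_comp]
    have := norm_sub_le_of_slice (f := h.comp π) (g := g.comp π) (κ := ε / 4) (τ := ε / 8) hP hr
      (by positivity) ((hπ h).trans_le hh) ((hπ g).trans_le hg) hx hx1 hhV hgV (by positivity) ?_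
    · linarith
    · intro z
      obtain ⟨w, hw, hwz⟩ := hC z
      have e : (h.comp π - g.comp π) (P m z) = (h.comp A - g.comp A) w := by
        simp [hw]
      rw [e]
      refine ((h.comp A - g.comp A).le_opNorm w).trans ?_
      calc ‖h.comp A - g.comp A‖ * ‖w‖ ≤ (3 * η) * ((|C| + 1) * ‖z‖) := by
            refine mul_le_mul hgh (hwz.trans ?_) (norm_nonneg _) (by positivity)
            gcongr
            linarith [le_abs_self C]
        _ = ε / 4 * ‖z‖ := by
            rw [hη]; field_simp; ring
  obtain ⟨y, hy, -⟩ := exists_szlenkDerivIter_near (ε := ε) A c hcη hη'.le hK hV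
    (fun g hg => hc g ((mem_closedBall_zero_iff.1 hg).trans hr)) hsmall β hg hgx
  rw [hβ _ hη'] at hy
  exact hy

/-- A constant loss of radius under `β` derivations exhausts the unit ball after finitely many
rounds. -/
theorem exists_szlenkDerivIter_mul_eq_empty {β : Ordinal.{u}} {ε δ : ℝ} (hδ : 0 < δ)
    (h : ∀ r ≤ 1, szlenkDerivIter ε (Metric.closedBall (0 : StrongDual 𝕜 G) r) β ⊆
      Metric.closedBall 0 (r - δ)) :
    ∃ n : ℕ, szlenkDerivIter ε (Metric.closedBall (0 : StrongDual 𝕜 G) 1) (β * n) = ∅ := by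
  have key : ∀ n : ℕ, szlenkDerivIter ε (Metric.closedBall (0 : StrongDual 𝕜 G) 1) (β * n) ⊆
      Metric.closedBall 0 (1 - n * δ) := by
    intro n
    induction n with
    | zero => simp [szlenkDerivIter_zero]
    | succ n ih =>
      rw [Nat.cast_succ, mul_add_one, Nat.cast_succ, add_mul, one_mul, ← sub_sub]
      exact (szlenkDerivIter_add_subset _ _ _ _).trans
        ((szlenkDerivIter_mono ε ih β).trans
          (h _ (sub_le_self _ (by positivity))))
  obtain ⟨n, hn⟩ := exists_nat_gt (1 / δ)
  refine ⟨n, Set.subset_empty_iff.1 ((key n).trans ?_)⟩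
  rw [Metric.closedBall_eq_empty.2]
  rw [div_lt_iff₀ hδ] at hn
  linarith

theorem indexLE_of_forall_exists_eq_empty {K : Set (StrongDual 𝕜 G)} {α : Ordinal.{u}}
    (h : ∀ ε > 0, ∃ n : ℕ, szlenkDerivIter ε K (ω ^ α * n) = ∅) :
    IndexLE (szlenkIndex K) (ω ^ (α + 1)) := by
  intro β hβ
  obtain ⟨ε, hε, hne⟩ := Set.mem_iUnion₂.1 hβ
  obtain ⟨n, hn⟩ := h ε hε
  have hlt : β < ω ^ α * n := by
    by_contra! hle
    have hne' : (szlenkDerivIter ε K β).Nonempty := hne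
    exact (hne'.mono (szlenkDerivIter_antitone ε K hle)).ne_empty hn
  refine hlt.trans ?_
  rw [Ordinal.opow_add_one]
  exact mul_lt_mul_of_pos_left (Ordinal.natCast_lt_omega0 n) (Ordinal.opow_pos α Ordinal.omega0_pos)

end Slices

/-! ### Functionals dominated by a sum of two seminorms -/

section HahnBanach

variable {𝕜 : Type v} [RCLike 𝕜] {E F : Type u} [NormedAddCommGroup E] [NormedSpace 𝕜 E]
  [NormedAddCommGroup F] [NormedSpace 𝕜 F]

/-- A functional dominated by `a ‖T x‖ + b ‖x‖` is within `b` of `a T*` of the dual unit ball. It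
factors through the embedding `x ↦ (a T x, b x)` into the `ℓ¹`-sum `F ⊕ E`, and the components of a
Hahn-Banach extension are the two summands. -/
theorem exists_norm_sub_smul_comp_le (T : E →L[𝕜] F) (f : StrongDual 𝕜 E) {a b : ℝ} (ha : 0 < a)
    (hb : 0 < b) (hf : ∀ x, ‖f x‖ ≤ a * ‖T x‖ + b * ‖x‖) :
    ∃ φ : StrongDual 𝕜 F, ‖φ‖ ≤ 1 ∧ ‖f - (a : 𝕜) • φ.comp T‖ ≤ b := by
  let J : E →ₗ[𝕜] WithLp 1 (F × E) :=
    (WithLp.linearEquiv 1 𝕜 (F × E)).symm.toLinearMap ∘ₗ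
      ((a : 𝕜) • T.toLinearMap).prod ((b : 𝕜) • LinearMap.id)
  have hJ : ∀ x, J x = WithLp.toLp 1 ((a : 𝕜) • T x, (b : 𝕜) • x) := fun x => rfl
  have hJn : ∀ x, ‖J x‖ = a * ‖T x‖ + b * ‖x‖ := by
    intro x
    rw [hJ, WithLp.prod_norm_eq_of_L1]
    simp [norm_smul, abs_of_pos ha, abs_of_pos hb]
  have hinj : Function.Injective J := by
    rw [← LinearMap.ker_eq_bot, LinearMap.ker_eq_bot']
    intro x hx
    have h0 := hJn x
    rw [hx, norm_zero] at h0
    have : b * ‖x‖ ≤ 0 := by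
      have : 0 ≤ a * ‖T x‖ := by positivity
      linarith
    exact norm_le_zero_iff.1 (by nlinarith [norm_nonneg x])
  let e := LinearEquiv.ofInjective J hinj
  let f₀ : StrongDual 𝕜 (LinearMap.range J) :=
    LinearMap.mkContinuous (f.toLinearMap ∘ₗ e.symm.toLinearMap) 1 (by
      intro y
      obtain ⟨x, rfl⟩ := e.surjective y
      have : ‖e x‖ = ‖J x‖ := rfl
      rw [this, hJn, one_mul]
      simpa using hf x)
  obtain ⟨Φ, hΦ, hΦn⟩ := exists_extension_norm_eq (LinearMap.range J) f₀
  have hΦ1 : ‖Φ‖ ≤ 1 := hΦn.trans_le (LinearMap.mkContinuous_norm_le _ zero_le_one _)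
  have hΦJ : ∀ x, Φ (J x) = f x := by
    intro x
    have := hΦ (e x)
    have h2 : f₀ (e x) = f x := by
      change f (e.symm (e x)) = f x
      rw [e.symm_apply_apply]
    rw [← h2, ← this]
    rfl
  let φ : StrongDual 𝕜 F := LinearMap.mkContinuous
    (Φ.toLinearMap ∘ₗ (WithLp.linearEquiv 1 𝕜 (F × E)).symm.toLinearMap ∘ₗ LinearMap.inl 𝕜 F E) 1
    (fun y => (Φ.le_of_opNorm_le hΦ1 _).trans (by
      simp))
  refine ⟨φ, LinearMap.mkContinuous_norm_le _ zero_le_one _, ?_⟩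
  refine ContinuousLinearMap.opNorm_le_bound _ hb.le fun x => ?_
  have e2 : (f - (a : 𝕜) • φ.comp T) x = Φ (WithLp.toLp 1 (0, (b : 𝕜) • x)) := by
    have h3 : φ (T x) = Φ (WithLp.toLp 1 (T x, 0)) := rfl
    have h4 : J x = (a : 𝕜) • WithLp.toLp 1 (T x, 0) + WithLp.toLp 1 (0, (b : 𝕜) • x) := by
      rw [hJ, ← WithLp.toLp_smul, ← WithLp.toLp_add]
      simp
    simp only [sub_apply, smul_apply,
      ContinuousLinearMap.comp_apply]
    rw [← hΦJ, h4, map_add, map_smul, h3, add_sub_cancel_left]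
  rw [e2]
  refine (Φ.le_of_opNorm_le hΦ1 _).trans ?_
  simp [norm_smul, abs_of_pos hb]

end HahnBanach

/-! ### The interpolation space -/

section Series

variable {𝕜 : Type*} [RCLike 𝕜] {X F : Type*} [NormedAddCommGroup X] [NormedSpace 𝕜 X]
  [NormedAddCommGroup F] [NormedSpace 𝕜 F]

theorem hasSum_tsum_apply {u : ℕ → X →L[𝕜] F} (hu : Summable u) (z : X) :
    HasSum (fun n => u n z) ((∑' n, u n) z) :=
  (ContinuousLinearMap.apply 𝕜 F z).hasSum hu.hasSum

theorem norm_geometric_smul_le {u : X →L[𝕜] F} (hu : ‖u‖ ≤ 1) (n : ℕ) :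
    ‖((2 ^ n)⁻¹ : 𝕜) • u‖ ≤ (1 / 2) ^ n := by
  rw [norm_smul, norm_inv, norm_pow, RCLike.norm_ofNat, one_div, inv_pow]
  exact mul_le_of_le_one_right (by positivity) hu

theorem summable_geometric_smul [CompleteSpace F] {u : ℕ → X →L[𝕜] F} (hu : ∀ n, ‖u n‖ ≤ 1) :
    Summable fun n : ℕ => ((2 ^ n)⁻¹ : 𝕜) • u n :=
  Summable.of_norm_bounded summable_geometric_two fun n => norm_geometric_smul_le (hu n) n

end Series

section Interpolation

variable {𝕜 : Type v} [RCLike 𝕜] {E F : Type u} [NormedAddCommGroup E] [NormedSpace 𝕜 E]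
  [NormedAddCommGroup F] [NormedSpace 𝕜 F]

open Filter Topology

/-- The `ℓ²`-direct sum of the renormings `x ↦ max (2ⁿ ‖T x‖) (2⁻ⁿ ‖x‖)` of `E`. The vector `x` of
the `n`-th summand is encoded as the pair `(2ⁿ T x, 2⁻ⁿ x)` in `F × E` with the maximum norm, so
that the sum is a subspace of `ℓ²(F × E)`. -/
def weightedSum (T : E →L[𝕜] F) : Submodule 𝕜 (lp (fun _ : ℕ => F × E) 2) where
  carrier := {z | ∀ n, (z n).1 = (4 ^ n : 𝕜) • T (z n).2}
  zero_mem' n := by simp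
  add_mem' hz hw n := by simp [hz n, hw n]
  smul_mem' c z hz n := by simp [hz n, smul_comm c]

theorem isClosed_weightedSum (T : E →L[𝕜] F) :
    IsClosed (weightedSum T : Set (lp (fun _ : ℕ => F × E) 2)) := by
  have h : ∀ n, Continuous fun z : lp (fun _ : ℕ => F × E) 2 => z n := fun n =>
    (lp.evalCLM 𝕜 (fun _ : ℕ => F × E) 2 n).continuous
  have : (weightedSum T : Set (lp (fun _ : ℕ => F × E) 2)) =
      ⋂ n : ℕ, {z | (z n).1 = (4 ^ n : 𝕜) • T (z n).2} := by
    ext z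
    simp only [Set.mem_iInter]
    exact Iff.rfl
  rw [this]
  exact isClosed_iInter fun n => isClosed_eq (h n).fst
    ((T.continuous.comp (h n).snd).const_smul _)

instance [CompleteSpace E] [CompleteSpace F] (T : E →L[𝕜] F) : CompleteSpace (weightedSum T) :=
  (isClosed_weightedSum T).completeSpace_coe

theorem fst_eq_of_mem_weightedSum {T : E →L[𝕜] F} (z : weightedSum T) (n : ℕ) :
    ((z : lp (fun _ : ℕ => F × E) 2) n).1 =
      (4 ^ n : 𝕜) • T ((z : lp (fun _ : ℕ => F × E) 2) n).2 :=
  z.2 n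

theorem norm_coord_le {T : E →L[𝕜] F} (z : weightedSum T) (n : ℕ) :
    ‖(z : lp (fun _ : ℕ => F × E) 2) n‖ ≤ ‖z‖ :=
  lp.norm_apply_le_norm two_ne_zero _ n

/-- The embedding of `E` as the `n`-th summand. -/
noncomputable def summand (T : E →L[𝕜] F) (n : ℕ) : E →L[𝕜] weightedSum T :=
  ((lp.singleContinuousLinearMap 𝕜 (fun _ : ℕ => F × E) 2 n).comp
    (((2 ^ n : 𝕜) • T).prod (((2 ^ n)⁻¹ : 𝕜) • ContinuousLinearMap.id 𝕜 E))).codRestrict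
    (weightedSum T) (by
      intro x k
      rcases eq_or_ne k n with rfl | hk
      · have h : (4 ^ k : 𝕜) * (2 ^ k)⁻¹ = 2 ^ k := by
          rw [show (4 : 𝕜) = 2 * 2 by norm_num, mul_pow]
          field_simp
        simp [smul_smul, h]
      · simp [hk])

theorem coe_summand (T : E →L[𝕜] F) (n : ℕ) (x : E) :
    (summand T n x : lp (fun _ : ℕ => F × E) 2) =
      lp.single 2 n ((2 ^ n : 𝕜) • T x, ((2 ^ n)⁻¹ : 𝕜) • x) :=
  rfl

theorem norm_summand_le (T : E →L[𝕜] F) (n : ℕ) (x : E) :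
    ‖summand T n x‖ ≤ 2 ^ n * ‖T x‖ + (2 ^ n)⁻¹ * ‖x‖ := by
  change ‖(summand T n x : lp (fun _ : ℕ => F × E) 2)‖ ≤ _
  rw [coe_summand, lp.norm_single two_pos, Prod.norm_mk, norm_smul,
    norm_smul, norm_inv, norm_pow, RCLike.norm_ofNat]
  exact max_le_add_of_nonneg (by positivity) (by positivity)

/-- The vector of `E` encoded by the `n`-th coordinate. -/
noncomputable def coordVec (T : E →L[𝕜] F) (n : ℕ) : weightedSum T →ₗ[𝕜] E :=
  (2 ^ n : 𝕜) • ((ContinuousLinearMap.snd 𝕜 F E).comp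
    ((lp.evalCLM 𝕜 (fun _ : ℕ => F × E) 2 n).comp (weightedSum T).subtypeL)).toLinearMap

theorem coordVec_apply (T : E →L[𝕜] F) (n : ℕ) (z : weightedSum T) :
    coordVec T n z = (2 ^ n : 𝕜) • ((z : lp (fun _ : ℕ => F × E) 2) n).2 :=
  rfl

theorem norm_coordVec_le (T : E →L[𝕜] F) (n : ℕ) (z : weightedSum T) :
    ‖coordVec T n z‖ ≤ 2 ^ n * ‖z‖ := by
  rw [coordVec_apply, norm_smul, norm_pow, RCLike.norm_ofNat]
  gcongr
  exact (norm_snd_le _).trans (norm_coord_le z n)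

theorem coe_summand_coordVec (T : E →L[𝕜] F) (n : ℕ) (z : weightedSum T) :
    (summand T n (coordVec T n z) : lp (fun _ : ℕ => F × E) 2) =
      lp.single 2 n ((z : lp (fun _ : ℕ => F × E) 2) n) := by
  rw [coe_summand, coordVec_apply]
  congr 1
  ext1
  · have h : (2 ^ n : 𝕜) * 2 ^ n = 4 ^ n := by
      rw [← mul_pow]; norm_num
    rw [fst_eq_of_mem_weightedSum, map_smul, smul_smul, h]
  · simp [smul_smul]

/-- The projection onto the first `m` summands. -/
noncomputable def initialSegment (T : E →L[𝕜] F) (m : ℕ) : weightedSum T →ₗ[𝕜] weightedSum T :=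
  ∑ n ∈ Finset.range m, (summand T n).toLinearMap ∘ₗ coordVec T n

theorem initialSegment_apply (T : E →L[𝕜] F) (m : ℕ) (z : weightedSum T) :
    initialSegment T m z = ∑ n ∈ Finset.range m, summand T n (coordVec T n z) := by
  simp [initialSegment]

theorem coe_initialSegment (T : E →L[𝕜] F) (m : ℕ) (z : weightedSum T) :
    (initialSegment T m z : lp (fun _ : ℕ => F × E) 2) =
      ∑ n ∈ Finset.range m, lp.single 2 n ((z : lp (fun _ : ℕ => F × E) 2) n) := by
  simp only [initialSegment_apply, Submodule.coe_sum, coe_summand_coordVec]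

theorem isPythagorean_initialSegment (T : E →L[𝕜] F) : IsPythagorean (initialSegment T) where
  norm_sq m z := by
    have h2 : 0 < (2 : ENNReal).toReal := by norm_num
    have h1 := lp.norm_compl_sum_single h2 (z : lp (fun _ : ℕ => F × E) 2) (Finset.range m)
    rw [← lp.norm_sum_single h2, ← coe_initialSegment, ← Submodule.coe_sub] at h1
    simp only [ENNReal.toReal_ofNat, Real.rpow_ofNat] at h1
    change ‖z - initialSegment T m z‖ ^ 2 = ‖z‖ ^ 2 - ‖initialSegment T m z‖ ^ 2 at h1
    linarith
  idem m z := by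
    ext1
    rw [coe_initialSegment]
    conv_rhs => rw [coe_initialSegment]
    refine Finset.sum_congr rfl fun n hn => ?_
    congr 1
    rw [coe_initialSegment, lp.coeFn_sum, Finset.sum_apply, Finset.sum_eq_single n]
    · exact lp.single_apply_self _ _ _
    · exact fun k _ hk => lp.single_apply_ne _ _ _ hk.symm
    · exact fun h => absurd hn h
  tendsto z := by
    rw [tendsto_subtype_rng]
    simp only [coe_initialSegment]
    exact (lp.hasSum_single ENNReal.ofNat_ne_top (z : lp (fun _ : ℕ => F × E) 2)).tendsto_sum_nat

/-- The `F`-component of the `n`-th coordinate, that is, `2ⁿ T xₙ`. -/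
noncomputable def coordImage (T : E →L[𝕜] F) (n : ℕ) : weightedSum T →L[𝕜] F :=
  (ContinuousLinearMap.fst 𝕜 F E).comp
    ((lp.evalCLM 𝕜 (fun _ : ℕ => F × E) 2 n).comp (weightedSum T).subtypeL)

theorem coordImage_apply (T : E →L[𝕜] F) (n : ℕ) (z : weightedSum T) :
    coordImage T n z = ((z : lp (fun _ : ℕ => F × E) 2) n).1 :=
  rfl

theorem norm_coordImage_le (T : E →L[𝕜] F) (n : ℕ) : ‖coordImage T n‖ ≤ 1 :=
  ContinuousLinearMap.opNorm_le_bound _ zero_le_one fun z => by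
    rw [one_mul]
    exact (norm_fst_le _).trans (norm_coord_le z n)

/-- The summation operator `(xₙ) ↦ ∑ T xₙ`; since the `n`-th coordinate has `F`-component
`2ⁿ T xₙ`, this is a geometrically convergent series of coordinate maps. -/
noncomputable def imageSum (T : E →L[𝕜] F) : weightedSum T →L[𝕜] F :=
  ∑' n : ℕ, ((2 ^ n)⁻¹ : 𝕜) • coordImage T n

theorem hasSum_imageSum [CompleteSpace F] (T : E →L[𝕜] F) (z : weightedSum T) :
    HasSum (fun n : ℕ => ((2 ^ n)⁻¹ : 𝕜) • coordImage T n z) (imageSum T z) :=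
  hasSum_tsum_apply (summable_geometric_smul (norm_coordImage_le T)) z

theorem imageSum_summand [CompleteSpace F] (T : E →L[𝕜] F) (n : ℕ) (x : E) :
    imageSum T (summand T n x) = T x := by
  refine (hasSum_imageSum T _).unique ?_
  convert hasSum_single n ?_ using 1
  · rw [coordImage_apply, coe_summand, lp.single_apply_self, smul_smul, inv_mul_cancel₀ (by simp),
      one_smul]
  · intro k hk
    rw [coordImage_apply, coe_summand, lp.single_apply_ne _ _ _ hk, Prod.fst_zero, smul_zero]

instance (T : E →L[𝕜] F) :
    IsClosed (LinearMap.ker (imageSum T).toLinearMap : Set (weightedSum T)) :=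
  (imageSum T).isClosed_ker

/-- The space through which `T` is factored: the quotient of the weighted `ℓ²`-sum by the kernel
of the summation operator. -/
def InterpolationSpace (T : E →L[𝕜] F) : Type u :=
  weightedSum T ⧸ LinearMap.ker (imageSum T).toLinearMap

noncomputable instance (T : E →L[𝕜] F) : NormedAddCommGroup (InterpolationSpace T) :=
  Submodule.Quotient.normedAddCommGroup (LinearMap.ker (imageSum T).toLinearMap)

noncomputable instance (T : E →L[𝕜] F) : NormedSpace 𝕜 (InterpolationSpace T) :=
  Submodule.Quotient.normedSpace (LinearMap.ker (imageSum T).toLinearMap) 𝕜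

instance [CompleteSpace E] [CompleteSpace F] (T : E →L[𝕜] F) :
    CompleteSpace (InterpolationSpace T) :=
  Submodule.Quotient.completeSpace (LinearMap.ker (imageSum T).toLinearMap)

/-- The quotient map onto the interpolation space. -/
noncomputable def toInterpolation (T : E →L[𝕜] F) : weightedSum T →L[𝕜] InterpolationSpace T :=
  (LinearMap.ker (imageSum T).toLinearMap).mkQL

theorem norm_toInterpolation_le (T : E →L[𝕜] F) (z : weightedSum T) :
    ‖toInterpolation T z‖ ≤ ‖z‖ :=
  Submodule.Quotient.norm_mk_le _ z

theorem norm_comp_toInterpolation (T : E →L[𝕜] F) (g : StrongDual 𝕜 (InterpolationSpace T)) :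
    ‖g.comp (toInterpolation T)‖ = ‖g‖ := by
  apply le_antisymm
  · refine ContinuousLinearMap.opNorm_le_bound _ (norm_nonneg _) fun z => ?_
    exact (g.le_opNorm _).trans
      (mul_le_mul_of_nonneg_left (norm_toInterpolation_le T z) (norm_nonneg _))
  · refine ContinuousLinearMap.opNorm_le_bound g
      (norm_nonneg (g.comp (toInterpolation T))) fun y => ?_
    refine le_of_forall_pos_le_add fun δ hδ => ?_
    set c := ‖g.comp (toInterpolation T)‖ with hc
    have hc0 : 0 ≤ c := norm_nonneg (g.comp (toInterpolation T))
    obtain ⟨z, rfl, hz⟩ := Submodule.Quotient.norm_mk_lt y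
      (show 0 < δ / (c + 1) by positivity)
    refine ((g.comp (toInterpolation T)).le_opNorm z).trans ?_
    rw [← hc]
    refine (mul_le_mul_of_nonneg_left hz.le hc0).trans ?_
    rw [mul_add]
    refine add_le_add le_rfl ?_
    rw [mul_div_left_comm]
    exact mul_le_of_le_one_right hδ.le (div_le_one_of_le₀ (by linarith) (by positivity))

/-- All summands have the same image in the quotient, because `T x` does not depend on the summand
in which `x` is placed. -/
theorem toInterpolation_summand [CompleteSpace F] (T : E →L[𝕜] F) (n : ℕ) (x : E) :
    toInterpolation T (summand T n x) = toInterpolation T (summand T 0 x) := by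
  refine (Submodule.Quotient.eq _).2 (LinearMap.mem_ker.2 ?_)
  rw [ContinuousLinearMap.coe_coe, map_sub, imageSum_summand, imageSum_summand, sub_self]

/-- The adjoint of `E → G` maps the dual unit ball of the interpolation space `G` into arbitrarily
small neighbourhoods of multiples of `T*` of the dual unit ball of `F`: place `x` in the `n`-th
summand for large `n`. -/
theorem exists_near_adjoint_image [CompleteSpace F] (T : E →L[𝕜] F) {η : ℝ} (hη : 0 < η) :
    ∃ c : 𝕜, ∀ g : StrongDual 𝕜 (InterpolationSpace T), ‖g‖ ≤ 1 →
      ∃ y ∈ (fun f : StrongDual 𝕜 F => f.comp T) '' Metric.closedBall (0 : StrongDual 𝕜 F) 1,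
        ‖g.comp ((toInterpolation T).comp (summand T 0)) - c • y‖ ≤ η := by
  obtain ⟨n, hn⟩ := exists_pow_lt_of_lt_one hη (show (2⁻¹ : ℝ) < 1 by norm_num)
  refine ⟨((2 ^ n : ℝ) : 𝕜), fun g hg => ?_⟩
  obtain ⟨φ, hφ, hφn⟩ := exists_norm_sub_smul_comp_le T
    (g.comp ((toInterpolation T).comp (summand T 0))) (a := 2 ^ n) (b := (2 ^ n)⁻¹)
    (by positivity) (by positivity) (fun x => by
      rw [ContinuousLinearMap.comp_apply, ContinuousLinearMap.comp_apply,
        ← toInterpolation_summand T n x]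
      refine (g.le_of_opNorm_le hg _).trans ?_
      rw [one_mul]
      exact (norm_toInterpolation_le T _).trans (norm_summand_le T n x))
  refine ⟨φ.comp T, ⟨φ, mem_closedBall_zero_iff.2 hφ, rfl⟩, hφn.trans ?_⟩
  rw [← inv_pow]
  exact hn.le

theorem indexLE_interpolationSpace [CompleteSpace F] (T : E →L[𝕜] F) {α : Ordinal.{u}}
    (hT : IndexLE (opSzlenkIndex T) (ω ^ α)) :
    IndexLE (spaceSzlenkIndex 𝕜 (InterpolationSpace T)) (ω ^ (α + 1)) := by
  have hempty : ∀ ε > 0, szlenkDerivIter ε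
      ((fun f : StrongDual 𝕜 F => f.comp T) '' Metric.closedBall (0 : StrongDual 𝕜 F) 1)
      (ω ^ α) = ∅ := by
    intro ε hε
    by_contra hne
    exact lt_irrefl (ω ^ α) (hT (Set.mem_iUnion₂.2 ⟨ε, hε, Set.nonempty_iff_ne_empty.2 hne⟩))
  refine indexLE_of_forall_exists_eq_empty fun ε hε =>
    exists_szlenkDerivIter_mul_eq_empty (δ := (ε / 8) ^ 2 / 2) (by positivity) fun r hr => ?_
  refine szlenkDerivIter_closedBall_subset (isPythagorean_initialSegment T)
    ((toInterpolation T).comp (summand T 0)) (norm_comp_toInterpolation T) (fun m => ?_)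
    (isCompact_adjoint_image T) (fun η hη => exists_near_adjoint_image T hη) hempty hε hr
  refine ⟨∑ n ∈ Finset.range m, 2 ^ n, fun z =>
    ⟨∑ n ∈ Finset.range m, coordVec T n z, ?_, ?_⟩⟩
  · rw [initialSegment_apply, map_sum, map_sum]
    exact Finset.sum_congr rfl fun n _ => toInterpolation_summand T n _
  · rw [Finset.sum_mul]
    exact norm_sum_le_of_le _ fun n _ => norm_coordVec_le T n z

/-- The operator induced by summation on the quotient. -/
noncomputable def ofInterpolation (T : E →L[𝕜] F) : InterpolationSpace T →L[𝕜] F :=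
  (LinearMap.ker (imageSum T).toLinearMap).liftQL (imageSum T) le_rfl

theorem ofInterpolation_comp [CompleteSpace F] (T : E →L[𝕜] F) :
    T = (ofInterpolation T).comp ((toInterpolation T).comp (summand T 0)) := by
  ext x
  exact (imageSum_summand T 0 x).symm

end Interpolation

theorem opSzlenkIndex_id (𝕜 : Type v) [RCLike 𝕜] (G : Type u) [NormedAddCommGroup G]
    [NormedSpace 𝕜 G] : opSzlenkIndex (ContinuousLinearMap.id 𝕜 G) = spaceSzlenkIndex 𝕜 G := by
  simp [opSzlenkIndex, spaceSzlenkIndex]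

end SzlenkFactorization

theorem theorem3p1 (𝕜 : Type v) [RCLike 𝕜] (α : Ordinal.{u}) :
    SzlenkFactorization.HasFactorizationProperty
        (SzlenkFactorization.szlenkOperators 𝕜 α)
        (SzlenkFactorization.szlenkOperators 𝕜 (α + 1)) ∧
      ∀ (E F : Type u) [NormedAddCommGroup E] [NormedSpace 𝕜 E] [CompleteSpace E]
        [NormedAddCommGroup F] [NormedSpace 𝕜 F] [CompleteSpace F] (T : E →L[𝕜] F),
        SzlenkFactorization.szlenkOperators 𝕜 α E F T →
          ∃ (G : Type u) (_ : NormedAddCommGroup G) (_ : NormedSpace 𝕜 G) (_ : CompleteSpace G)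
            (A : E →L[𝕜] G) (B : G →L[𝕜] F),
            SzlenkFactorization.IndexLE (SzlenkFactorization.spaceSzlenkIndex 𝕜 G)
                (ω ^ (α + 1)) ∧
              T = B.comp A := by
  have key : ∀ (E F : Type u) [NormedAddCommGroup E] [NormedSpace 𝕜 E] [CompleteSpace E]
        [NormedAddCommGroup F] [NormedSpace 𝕜 F] [CompleteSpace F] (T : E →L[𝕜] F),
        SzlenkFactorization.szlenkOperators 𝕜 α E F T →
          ∃ (G : Type u) (_ : NormedAddCommGroup G) (_ : NormedSpace 𝕜 G) (_ : CompleteSpace G)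
            (A : E →L[𝕜] G) (B : G →L[𝕜] F),
            SzlenkFactorization.IndexLE (SzlenkFactorization.spaceSzlenkIndex 𝕜 G)
                (ω ^ (α + 1)) ∧
              T = B.comp A := fun E F _ _ _ _ _ _ T hT =>
    ⟨SzlenkFactorization.InterpolationSpace T, inferInstance, inferInstance, inferInstance,
      (SzlenkFactorization.toInterpolation T).comp (SzlenkFactorization.summand T 0),
      SzlenkFactorization.ofInterpolation T, SzlenkFactorization.indexLE_interpolationSpace T hT,
      SzlenkFactorization.ofInterpolation_comp T⟩
  refine ⟨fun E F _ _ _ _ _ _ T hT => ?_, key⟩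
  obtain ⟨G, _, _, _, A, B, hG, hBA⟩ := key E F T hT
  refine ⟨G, _, _, ‹_›, A, B, ?_, hBA⟩
  rw [← SzlenkFactorization.opSzlenkIndex_id] at hG
  exact hG
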